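/- Let $(M,\in^M)$ be a model of $\mathsf{ZF}$ (not assumed well-founded); "definable" means first-order definable with parameters. An inner model of $\mathsf{ZF}$ (of $\mathsf{ZFC}$) of $M$ is a definable transitive class containing all ordinals of $M$ and satisfying $\mathsf{ZF}$ ($\mathsf{ZFC}$). (1) Let $\lambda$ be an ordinal of $M$ and let $\langle W_i : i<\lambda\rangle$ be a definable decreasing sequence of inner models of $\mathsf{ZF}$ of $M$ such that for every $i<\lambda$ the tail $\langle W_j : i<j<\lambda\rangle$ is definable in $W_i$. Then $\bigcap_{i<\lambda}W_i$ is an inner model of $\mathsf{ZF}$ of $M$ (for $\lambda=0$ the intersection is $M$). (2) In particular, the following holds for limit stages of the sequence of inner mantles. A ground of a model $N$ is an inner model $U$ of $\mathsf{ZFC}$ of $N$ such that $N=U[G]$ for some $G\in N$ that is generic over $U$ for a poset in $U$; the mantle of $N$ is the intersection of its grounds. The inner mantles of $M$ are $\mathrm M^0=M$, $\mathrm M^{\eta+1}=$ the mantle of $\mathrm M^\eta$, and $\mathrm M^\eta=\bigcap_{\xi<\eta}\mathrm M^\xi$ for limit $\eta$. Let $\gamma>0$ be a limit ordinal of $M$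 for which the sequence $\langle \mathrm M^\eta:\eta<\gamma\rangle$ is given by this recursion, where either the ordinals of $M$ below $\gamma$ are truly well-founded (and the recursion is carried out in the meta-theory), or $\langle \mathrm M^\xi:\xi<\eta\rangle$ is definable in $M$ for every $\eta<\gamma$. Suppose that $\mathrm M^\eta\models\mathsf{ZFC}$ for all $\eta<\gamma$, and that $\mathrm M^\gamma=\bigcap_{\eta<\gamma}\mathrm M^\eta$ is a definable class of $M=\mathrm M^0$ and, more generally, of each $\mathrm M^\eta$, $\eta<\gamma$. Then $\mathrm M^\gamma$ is an inner model of $\mathsf{ZF}$ of $M$. -/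

import Mathlib

universe u

/-! ### Structures for the language of set theory -/

/-- A structure for the language of set theory: a type with a binary relation `x ∈ₘ y`.
The relation is not assumed to be well-founded. -/
class EpsStructure (M : Type u) where
  eps : M → M → Prop

infix:50 " ∈ₘ " => EpsStructure.eps

/-- The only symbol of the language of set theory is a binary relation symbol. -/
inductive SetLangRel : ℕ → Type
  | mem : SetLangRel 2

/-- The first-order language of set theory. -/
def setLang : FirstOrder.Language.{0, 0} := ⟨fun _ => Empty, SetLangRel⟩

instance EpsStructure.toStructure (M : Type u) [EpsStructure M] : setLang.Structure M where
  funMap := fun f => Empty.elim f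
  RelMap := fun {_} r =>
    match r with
    | SetLangRel.mem => fun v => v 0 ∈ₘ v 1

/-- A class `W` of a structure, as a structure with the inherited membership relation. -/
instance EpsStructure.onClass {M : Type u} [EpsStructure M] (W : Set M) : EpsStructure W where
  eps := fun x y => (x : M) ∈ₘ (y : M)

section Basic

variable {M : Type u} [EpsStructure M]

/-- `P` is a definable class: first-order definable with parameters from the structure. -/
def DefinableClass (P : Set M) : Prop :=
  (Set.univ : Set M).Definable₁ setLang P

/-- `R` is a class of pairs that is first-order definable with parameters. -/
def DefinableRel (R : Set (M × M)) : Prop :=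
  (Set.univ : Set M).Definable₂ setLang R

def IsEmptySet (x : M) : Prop := ∀ z : M, ¬ z ∈ₘ x

def IsSubsetOf (x y : M) : Prop := ∀ z : M, z ∈ₘ x → z ∈ₘ y

/-- `y = x ∪ {x}`. -/
def IsSuccOf (y x : M) : Prop := ∀ z : M, z ∈ₘ y ↔ z ∈ₘ x ∨ z = x

/-- `c = {a, b}`. -/
def IsUPair (c a b : M) : Prop := ∀ z : M, z ∈ₘ c ↔ z = a ∨ z = b

/-- `c = (a, b) = {{a}, {a, b}}`. -/
def IsOPair (c a b : M) : Prop := ∃ s t : M, IsUPair s a a ∧ IsUPair t a b ∧ IsUPair c s t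

/-- `(a, b) ∈ r`. -/
def HasPair (r a b : M) : Prop := ∃ c : M, IsOPair c a b ∧ c ∈ₘ r

def IsTransSet (x : M) : Prop := ∀ y : M, y ∈ₘ x → IsSubsetOf y x

/-- Ordinals of the structure: transitive sets of transitive sets
(the usual definition in the presence of Foundation). -/
def IsOrdinal (x : M) : Prop := IsTransSet x ∧ ∀ y : M, y ∈ₘ x → IsTransSet y

/-- Nonzero limit ordinals of the structure. -/
def IsLimitOrdinal (x : M) : Prop :=
  IsOrdinal x ∧ (∃ y : M, y ∈ₘ x) ∧ ∀ y : M, y ∈ₘ x → ∃ z : M, z ∈ₘ x ∧ y ∈ₘ z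

end Basic

/-! ### Models of ZF and ZFC -/

/-- `M ⊨ ZF`. The two schemata range over all formulas with parameters from `M`. -/
structure IsModelZF (M : Type u) [EpsStructure M] : Prop where
  extensionality : ∀ x y : M, (∀ z : M, z ∈ₘ x ↔ z ∈ₘ y) → x = y
  foundation : ∀ x : M, (∃ y : M, y ∈ₘ x) → ∃ y : M, y ∈ₘ x ∧ ∀ z : M, z ∈ₘ y → ¬ z ∈ₘ x
  pairing : ∀ a b : M, ∃ c : M, IsUPair c a b
  union : ∀ a : M, ∃ b : M, ∀ x : M, x ∈ₘ b ↔ ∃ y : M, y ∈ₘ a ∧ x ∈ₘ y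
  powerset : ∀ a : M, ∃ b : M, ∀ x : M, x ∈ₘ b ↔ IsSubsetOf x a
  infinity : ∃ w : M, (∃ e : M, IsEmptySet e ∧ e ∈ₘ w) ∧
    ∀ x : M, x ∈ₘ w → ∃ y : M, IsSuccOf y x ∧ y ∈ₘ w
  separation : ∀ P : Set M, DefinableClass P →
    ∀ a : M, ∃ b : M, ∀ x : M, x ∈ₘ b ↔ x ∈ₘ a ∧ x ∈ P
  replacement : ∀ F : Set (M × M), DefinableRel F →
    ∀ a : M, (∀ x : M, x ∈ₘ a → ∃! y : M, (x, y) ∈ F) →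
      ∃ b : M, ∀ y : M, y ∈ₘ b ↔ ∃ x : M, x ∈ₘ a ∧ (x, y) ∈ F

/-- `M ⊨ AC`: every set of nonempty pairwise disjoint sets has a transversal. -/
def SatisfiesChoice (M : Type u) [EpsStructure M] : Prop :=
  ∀ a : M, (∀ x : M, x ∈ₘ a → ∃ z : M, z ∈ₘ x) →
    (∀ x y z : M, x ∈ₘ a → y ∈ₘ a → z ∈ₘ x → z ∈ₘ y → x = y) →
    ∃ c : M, ∀ x : M, x ∈ₘ a → ∃! z : M, z ∈ₘ x ∧ z ∈ₘ c

/-- `M ⊨ ZFC`. -/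
structure IsModelZFC (M : Type u) [EpsStructure M] : Prop where
  zf : IsModelZF M
  choice : SatisfiesChoice M

section Models

variable {M : Type u} [EpsStructure M]

/-- `W` is an inner model of ZF of `M`: a definable transitive class that contains all ordinals
and satisfies ZF. -/
structure IsInnerModelZF (W : Set M) : Prop where
  definable : DefinableClass W
  transitive : ∀ x y : M, y ∈ W → x ∈ₘ y → x ∈ W
  ordinals : ∀ x : M, IsOrdinal x → x ∈ W
  zf : IsModelZF W

/-- `W` is an inner model of ZFC of `M`. -/
structure IsInnerModelZFC (W : Set M) : Prop extends IsInnerModelZF W where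
  choice : SatisfiesChoice W

/-! ### Forcing extensions, grounds and the mantle -/

/-- `r` is a partial order on the set `p`. -/
structure IsPoset (p r : M) : Prop where
  refl : ∀ a : M, a ∈ₘ p → HasPair r a a
  trans : ∀ a b c : M, a ∈ₘ p → b ∈ₘ p → c ∈ₘ p → HasPair r a b → HasPair r b c → HasPair r a c
  antisymm : ∀ a b : M, a ∈ₘ p → b ∈ₘ p → HasPair r a b → HasPair r b a → a = b

/-- `d` is a dense subset of the poset `(p, r)`. -/
def IsDenseSubset (p r d : M) : Prop :=
  IsSubsetOf d p ∧ ∀ a : M, a ∈ₘ p → ∃ b : M, b ∈ₘ d ∧ HasPair r b a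

/-- `g` is a filter on the poset `(p, r)` that meets every dense subset of `p` lying in `W`. -/
structure IsGenericFilter (W : Set M) (p r g : M) : Prop where
  subset : IsSubsetOf g p
  nonempty : ∃ a : M, a ∈ₘ g
  upward : ∀ a b : M, a ∈ₘ g → b ∈ₘ p → HasPair r a b → b ∈ₘ g
  directed : ∀ a b : M, a ∈ₘ g → b ∈ₘ g → ∃ c : M, c ∈ₘ g ∧ HasPair r c a ∧ HasPair r c b
  generic : ∀ d : M, d ∈ W → IsDenseSubset p r d → ∃ a : M, a ∈ₘ d ∧ a ∈ₘ g

/-- The set `f` of ordered pairs is (a piece of) the function that evaluates names by `g`: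
its domain contains with `s` every `t` such that `(t, a) ∈ s` for some `a ∈ g`, and
`f(s) = {f(t) : (t, a) ∈ s for some a ∈ g}`. -/
structure IsEvaluation (g f : M) : Prop where
  functional : ∀ s x y : M, HasPair f s x → HasPair f s y → x = y
  closed : ∀ s x t a : M, HasPair f s x → a ∈ₘ g → HasPair s t a → ∃ y : M, HasPair f t y
  value : ∀ s x : M, HasPair f s x →
    ∀ y : M, y ∈ₘ x ↔ ∃ t a : M, a ∈ₘ g ∧ HasPair s t a ∧ HasPair f t y

/-- The extension `W[g]`: the values under `g` of the names in `W`. -/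
def genericExtension (W : Set M) (g : M) : Set M :=
  {x : M | ∃ s : M, s ∈ W ∧ ∃ f : M, IsEvaluation g f ∧ HasPair f s x}

/-- `W` is a ground of `M`: an inner model of ZFC such that `M = W[g]` for some filter `g ∈ M`
that is generic over `W` for a poset `(p, r) ∈ W`. -/
def IsGround (W : Set M) : Prop :=
  IsInnerModelZFC W ∧ ∃ p r g : M, p ∈ W ∧ r ∈ W ∧ IsPoset p r ∧ IsGenericFilter W p r g ∧
    ∀ x : M, x ∈ genericExtension W g

end Models

/-- The mantle of the structure `M`: the intersection of all its grounds. -/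
def mantle (M : Type u) [EpsStructure M] : Set M :=
  {x : M | ∀ W : Set M, IsGround W → x ∈ W}

section InnerMantles

variable {M : Type u} [EpsStructure M]

/-- The mantle as computed in the structure `W`, viewed as a class of `M`. -/
def mantleOf (W : Set M) : Set M := Subtype.val '' mantle W

/-- The intersection of the classes `W i` over all `i ∈ₘ l`. -/
def interBelow (l : M) (W : M → Set M) : Set M :=
  {x : M | ∀ i : M, i ∈ₘ l → x ∈ W i}

/-- `S i`, for `i ∈ₘ c`, is the sequence of inner mantles of length `c`. The values of `S` at
other arguments are irrelevant. The recursion is along an initial segment of the ordinals of `M`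
that is really well-founded, or else its proper initial segments are definable in `M`, so that
it is a recursion in the sense of `M`; in both cases `c` determines the sequence. -/
structure IsInnerMantleSeq (c : M) (S : M → Set M) : Prop where
  zero : ∀ i : M, i ∈ₘ c → IsEmptySet i → S i = Set.univ
  succ : ∀ i j : M, i ∈ₘ c → j ∈ₘ c → IsSuccOf j i → S j = mantleOf (S i)
  limit : ∀ i : M, i ∈ₘ c → IsLimitOrdinal i → S i = interBelow i S
  recursion : Set.WellFoundedOn {i : M | i ∈ₘ c} EpsStructure.eps ∨
    ∀ k : M, k ∈ₘ c → DefinableRel {q : M × M | q.1 ∈ₘ k ∧ q.2 ∈ S q.1}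

end InnerMantles

/-! Let `U` be the intersection of transitive models `N i`, each containing the ordinals, and let
`U` be definable in every `N i`. Most axioms of ZF for `U` ask for a set of the form `{u ∈ U | Q
u}`. Each `N i` forms this set by the same axiom: a definition evaluated in `U` becomes a definition
in `N i` once its quantifiers are bounded by the definable class `U`
(`IsEpsEmbedding.exists_relativization`). By extensionality in `M` the sets obtained in the various
`N i` are one and the same, so this set lies in every `N i` and hence in `U`. Infinity holds because
`U` contains the ordinals. This is `isModelZF_of_iInter_range`.

In part (1), `U` is definable in `W i` from the tail after `i`, because the earlier terms contain `W
i`. In part (2), definability in each stage is given; what remains is that the stages are transitive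
and contain the ordinals, which is proved by induction along the recursion. -/

/-! ### A calculus of definable predicates -/

section DefinablePredicates

open FirstOrder FirstOrder.Language

variable {M : Type u} [EpsStructure M] {α β : Type*}

/-- The function `t` of an assignment is the value of a variable or of a parameter. -/
def IsTermFun (t : (α → M) → M) : Prop :=
  ∃ τ : setLang[[(Set.univ : Set M)]].Term α, ∀ v, τ.realize v = t v

/-- The predicate `P` of assignments is first-order definable with parameters. -/
def DefinablePred (P : (α → M) → Prop) : Prop :=
  ∃ φ : setLang[[(Set.univ : Set M)]].Formula α, ∀ v, φ.Realize v ↔ P v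

theorem IsTermFun.var (a : α) : IsTermFun fun v : α → M => v a := ⟨Term.var a, fun _ => rfl⟩

theorem IsTermFun.const (m : M) : IsTermFun fun _ : α → M => m :=
  ⟨Constants.term (setLang.con (⟨m, trivial⟩ : (Set.univ : Set M))), fun _ => by
    simp [Term.realize_constants]⟩

theorem DefinablePred.definable {P : (α → M) → Prop} (h : DefinablePred P) :
    (Set.univ : Set M).Definable setLang {v | P v} := by
  obtain ⟨φ, hφ⟩ := h
  exact ⟨φ, by ext v; exact (hφ v).symm⟩

theorem definablePred_of_definable {P : (α → M) → Prop}
    (h : (Set.univ : Set M).Definable setLang {v | P v}) : DefinablePred P := by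
  obtain ⟨φ, hφ⟩ := h
  exact ⟨φ, fun v => by
    have : v ∈ {v | P v} ↔ φ.Realize v := by rw [hφ]; rfl
    exact this.symm⟩

theorem DefinablePred.congr {P Q : (α → M) → Prop} (h : DefinablePred P) (e : ∀ v, P v ↔ Q v) :
    DefinablePred Q := by
  rwa [← show P = Q from funext fun v => propext (e v)]

theorem DefinablePred.mem {s t : (α → M) → M} (hs : IsTermFun s) (ht : IsTermFun t) :
    DefinablePred fun v => s v ∈ₘ t v := by
  obtain ⟨σ, hσ⟩ := hs
  obtain ⟨τ, hτ⟩ := ht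
  let r : setLang[[(Set.univ : Set M)]].Relations 2 := Sum.inl SetLangRel.mem
  refine ⟨r.formula₂ σ τ, fun v => ?_⟩
  rw [Formula.realize_rel₂, hσ, hτ]
  rfl

theorem DefinablePred.eq {s t : (α → M) → M} (hs : IsTermFun s) (ht : IsTermFun t) :
    DefinablePred fun v => s v = t v := by
  obtain ⟨σ, hσ⟩ := hs
  obtain ⟨τ, hτ⟩ := ht
  exact ⟨σ.equal τ, fun v => by rw [Formula.realize_equal, hσ, hτ]⟩

theorem DefinablePred.false : DefinablePred fun _ : α → M => False := ⟨⊥, fun _ => Iff.rfl⟩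

theorem DefinablePred.imp {P Q : (α → M) → Prop} (hP : DefinablePred P) (hQ : DefinablePred Q) :
    DefinablePred fun v => P v → Q v := by
  obtain ⟨φ, hφ⟩ := hP
  obtain ⟨ψ, hψ⟩ := hQ
  exact ⟨φ.imp ψ, fun v => by rw [Formula.realize_imp, hφ, hψ]⟩

theorem DefinablePred.not {P : (α → M) → Prop} (hP : DefinablePred P) :
    DefinablePred fun v => ¬ P v := hP.imp .false

theorem DefinablePred.and {P Q : (α → M) → Prop} (hP : DefinablePred P) (hQ : DefinablePred Q) :
    DefinablePred fun v => P v ∧ Q v :=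
  (hP.imp hQ.not).not.congr fun v => by tauto

theorem DefinablePred.or {P Q : (α → M) → Prop} (hP : DefinablePred P) (hQ : DefinablePred Q) :
    DefinablePred fun v => P v ∨ Q v :=
  (hP.not.imp hQ).congr fun v => by tauto

theorem DefinablePred.subst {P : (β → M) → Prop} (hP : DefinablePred P)
    {t : β → (α → M) → M} (ht : ∀ b, IsTermFun (t b)) :
    DefinablePred fun v => P fun b => t b v := by
  obtain ⟨φ, hφ⟩ := hP
  choose τ hτ using ht
  refine ⟨BoundedFormula.subst φ τ, fun v => ?_⟩
  rw [Formula.Realize, BoundedFormula.realize_subst]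
  simp only [hτ]
  exact hφ _

/-- Assignments have an arbitrary index type so that a quantifier can add the variable `.inr ()`.
Definability is then proved by following the shape of a predicate, without writing formulas. -/
theorem DefinablePred.all {P : (α → M) → M → Prop}
    (h : DefinablePred fun w : α ⊕ Unit → M => P (fun a => w (.inl a)) (w (.inr ()))) :
    DefinablePred fun v => ∀ x, P v x := by
  obtain ⟨φ, hφ⟩ := h
  refine ⟨φ.iAlls Unit, fun v => ?_⟩
  rw [Formula.realize_iAlls]
  exact ⟨fun H x => (hφ _).1 (H fun _ => x), fun H i => (hφ _).2 (H (i ()))⟩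

theorem DefinableClass.definablePred {P : Set M} (h : DefinableClass P)
    {t : (α → M) → M} (ht : IsTermFun t) : DefinablePred fun v => t v ∈ P :=
  (definablePred_of_definable (P := fun w : Fin 1 → M => w 0 ∈ P) h).subst
    (t := fun _ => t) fun _ => ht

theorem DefinableRel.definablePred {R : Set (M × M)} (h : DefinableRel R)
    {s t : (α → M) → M} (hs : IsTermFun s) (ht : IsTermFun t) :
    DefinablePred fun v => (s v, t v) ∈ R :=
  (definablePred_of_definable (P := fun w : Fin 2 → M => (w 0, w 1) ∈ R) h).subst
    (t := fun b => if b = 0 then s else t) fun b => by split <;> assumption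

/-- A unary predicate that is definable with parameters. -/
theorem DefinablePred.definableClass {P : M → Prop}
    (h : DefinablePred fun v : Unit → M => P (v ())) : DefinableClass {x | P x} :=
  (h.subst (α := Fin 1) (t := fun _ v => v 0) fun _ => .var 0).definable

/-- A map of structures that preserves and reflects membership and equality. -/
structure IsEpsEmbedding {A B : Type u} [EpsStructure A] [EpsStructure B] (f : A → B) : Prop where
  injective : Function.Injective f
  eps_iff : ∀ x y, f x ∈ₘ f y ↔ x ∈ₘ y

theorem isEpsEmbedding_val (W : Set M) : IsEpsEmbedding (Subtype.val : W → M) :=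
  ⟨Subtype.val_injective, fun _ _ => Iff.rfl⟩

/-! ### Relativization of definitions to a definable substructure -/

section Embedding

variable {A B : Type u} [EpsStructure A] [EpsStructure B] {f : A → B}

/-- Induction on the formula: atomic formulas are preserved by the embedding, and quantifiers are
bounded by the definable range of `f`. -/
theorem IsEpsEmbedding.exists_relativization (hf : IsEpsEmbedding f)
    (hr : DefinableClass (Set.range f)) {n : ℕ} (φ : setLang.BoundedFormula α n) :
    ∃ Q : (α ⊕ Fin n → B) → Prop, DefinablePred Q ∧
      ∀ (v : α → A) (xs : Fin n → A), φ.Realize v xs ↔ Q fun i => f (Sum.elim v xs i) := by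
  -- The language has no function symbols.
  have term : ∀ {n : ℕ} (t : setLang.Term (α ⊕ Fin n)), ∃ i, t = Term.var i := by
    intro n t
    cases t with
    | var i => exact ⟨i, rfl⟩
    | func g _ => exact Empty.elim g
  induction φ with
  | falsum => exact ⟨_, .false, fun _ _ => Iff.rfl⟩
  | equal s t =>
    obtain ⟨i, rfl⟩ := term s
    obtain ⟨j, rfl⟩ := term t
    exact ⟨_, .eq (.var i) (.var j), fun v xs => hf.injective.eq_iff.symm⟩
  | rel R ts =>
    cases R
    obtain ⟨i, hi⟩ := term (ts 0)
    obtain ⟨j, hj⟩ := term (ts 1)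
    refine ⟨_, .mem (.var i) (.var j), fun v xs => ?_⟩
    rw [hf.eps_iff]
    change (ts 0).realize _ ∈ₘ (ts 1).realize _ ↔ _
    rw [hi, hj]
    rfl
  | imp φ ψ ihφ ihψ =>
    obtain ⟨P, hP, eP⟩ := ihφ
    obtain ⟨Q, hQ, eQ⟩ := ihψ
    exact ⟨_, hP.imp hQ, fun v xs => by rw [BoundedFormula.realize_imp, eP, eQ]⟩
  | @all n φ ih =>
    obtain ⟨P, hP, eP⟩ := ih
    refine ⟨fun w => ∀ x, x ∈ Set.range f →
      P (Sum.elim (fun a => w (.inl a)) (Fin.snoc (fun i => w (.inr i)) x : Fin (n + 1) → B)),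
      .all (.imp (hr.definablePred (.var _)) (hP.subst fun b => ?_)), fun v xs => ?_⟩
    · rcases b with a | i
      · exact .var _
      · refine Fin.lastCases ?_ (fun i => ?_) i
        · simpa using IsTermFun.var _
        · simpa using IsTermFun.var _
    · refine BoundedFormula.realize_all.trans (Iff.trans ?_ Set.forall_mem_range.symm)
      refine forall_congr' fun x => ?_
      rw [eP]
      refine iff_of_eq (congrArg P (funext fun b => ?_))
      rcases b with a | i
      · rfl
      · refine Fin.lastCases ?_ (fun i => ?_) i <;> simp

/-- Parameters from `A` are first turned into free variables; after relativization their images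
under `f` are substituted as parameters from `B`. -/
theorem IsEpsEmbedding.exists_definablePred (hf : IsEpsEmbedding f)
    (hr : DefinableClass (Set.range f)) {P : (α → A) → Prop} (hP : DefinablePred P) :
    ∃ Q : (α → B) → Prop, DefinablePred Q ∧ ∀ v, P v ↔ Q fun i => f (v i) := by
  obtain ⟨φ, hφ⟩ := Set.definable_iff_exists_formula_sum.1 hP.definable
  obtain ⟨Q, hQ, e⟩ := hf.exists_relativization hr φ
  refine ⟨_, hQ.subst (t := fun b v => Sum.elim (Sum.elim (fun a => f a.1) v) finZeroElim b)
    fun b => ?_, fun v => ?_⟩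
  · rcases b with (a | i) | i
    · exact .const _
    · exact .var _
    · exact i.elim0
  · have : v ∈ {v | P v} ↔ φ.Realize (Sum.elim (fun a => a.1) v) := by rw [hφ]; rfl
    refine this.trans ((e _ _).trans (iff_of_eq (congrArg Q (funext fun b => ?_))))
    rcases b with (a | i) | i
    · rfl
    · rfl
    · exact i.elim0

theorem IsEpsEmbedding.definableClass_image (hf : IsEpsEmbedding f)
    (hr : DefinableClass (Set.range f)) {P : Set A} (hP : DefinableClass P) :
    DefinableClass (f '' P) := by
  obtain ⟨Q, hQ, e⟩ := hf.exists_definablePred hr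
    (hP.definablePred (IsTermFun.var ()))
  have : f '' P = {b | b ∈ Set.range f ∧ Q fun _ => b} := by
    ext b
    constructor
    · rintro ⟨a, ha, rfl⟩
      exact ⟨⟨a, rfl⟩, (e fun _ => a).1 ha⟩
    · rintro ⟨⟨a, rfl⟩, hb⟩
      exact ⟨a, (e fun _ => a).2 hb, rfl⟩
  rw [this]
  exact ((hr.definablePred (.var _)).and hQ).definableClass

theorem IsEpsEmbedding.definableRel_image (hf : IsEpsEmbedding f)
    (hr : DefinableClass (Set.range f)) {R : Set (A × A)} (hR : DefinableRel R) :
    DefinableRel (Prod.map f f '' R) := by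
  obtain ⟨Q, hQ, e⟩ := hf.exists_definablePred hr
    (hR.definablePred (IsTermFun.var (0 : Fin 2)) (IsTermFun.var 1))
  refine (((hr.definablePred (.var 0)).and (hr.definablePred (.var 1))).and hQ).congr
    (fun w => ?_) |>.definable
  constructor
  · rintro ⟨⟨⟨a, ha⟩, ⟨b, hb⟩⟩, hw⟩
    have : w = fun i => f (![a, b] i) := by
      funext i
      fin_cases i
      · exact ha.symm
      · exact hb.symm
    rw [this] at hw
    exact ⟨(a, b), (e _).2 hw, Prod.ext ha hb⟩
  · rintro ⟨⟨a, b⟩, hab, h⟩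
    obtain ⟨ha, hb⟩ := Prod.ext_iff.1 h
    refine ⟨⟨⟨a, ha⟩, ⟨b, hb⟩⟩, ?_⟩
    have : w = fun i => f (![a, b] i) := by
      funext i
      fin_cases i
      · exact ha.symm
      · exact hb.symm
    rw [this]
    exact (e ![a, b]).1 hab

end Embedding

end DefinablePredicates

/-! ### Ordinals of a model of ZF -/

section Ordinals

variable {M : Type u} [EpsStructure M]

theorem definablePred_isOrdinal {α : Type*} {t : (α → M) → M} (ht : IsTermFun t) :
    DefinablePred fun v => IsOrdinal (t v) := by
  have H : DefinablePred fun v : Unit → M => IsOrdinal (v ()) := by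
    refine .and ?_ (.all (.imp (.mem (.var _) (.var _)) ?_))
    · exact .all (.imp (.mem (.var _) (.var _)) (.all (.imp (.mem (.var _) (.var _))
        (.mem (.var _) (.var _)))))
    · exact .all (.imp (.mem (.var _) (.var _)) (.all (.imp (.mem (.var _) (.var _))
        (.mem (.var _) (.var _)))))
  exact H.subst (t := fun _ => t) fun _ => ht

theorem IsOrdinal.of_mem {x y : M} (hx : IsOrdinal x) (hy : y ∈ₘ x) : IsOrdinal y :=
  ⟨hx.2 y hy, fun z hz => hx.2 z (hx.1 y hy z hz)⟩

theorem IsOrdinal.trans {x y z : M} (hx : IsOrdinal x) (hz : z ∈ₘ y) (hy : y ∈ₘ x) : z ∈ₘ x :=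
  hx.1 y hy z hz

theorem IsOrdinal.isSuccOf {x y : M} (hx : IsOrdinal x) (hy : IsSuccOf y x) : IsOrdinal y := by
  refine ⟨fun z hz w hw => (hy w).2 ?_, fun z hz => ?_⟩
  · rcases (hy z).1 hz with h | rfl
    exacts [.inl (hx.trans hw h), .inl hw]
  · rcases (hy z).1 hz with h | rfl
    exacts [hx.2 z h, hx.1]

theorem IsModelZF.not_mem_self (hM : IsModelZF M) (x : M) : ¬ x ∈ₘ x := by
  intro h
  obtain ⟨c, hc⟩ := hM.pairing x x
  obtain ⟨y, hy, hy'⟩ := hM.foundation c ⟨x, (hc x).2 (.inl rfl)⟩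
  obtain rfl : y = x := by simpa using (hc y).1 hy
  exact hy' y h hy

/-- Induction on the ordinals of a model for definable predicates. -/
theorem IsModelZF.ordinal_induction (hM : IsModelZF M) {P : M → Prop}
    (hP : DefinablePred fun v : Unit → M => P (v ()))
    (step : ∀ x, IsOrdinal x → (∀ y, y ∈ₘ x → P y) → P x) (x : M) (hx : IsOrdinal x) : P x := by
  by_contra hn
  obtain ⟨d, hd⟩ := hM.separation {x | ¬ P x} hP.not.definableClass x
  have hne : ∃ y, y ∈ₘ d := by
    by_contra! hd'
    exact hn (step x hx fun y hy => by_contra fun h => hd' y ((hd y).2 ⟨hy, h⟩))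
  obtain ⟨y, hy, hmin⟩ := hM.foundation d hne
  obtain ⟨hyx, hyP⟩ := (hd y).1 hy
  exact hyP (step y (hx.of_mem hyx) fun z hz =>
    by_contra fun h => hmin z hz ((hd z).2 ⟨hx.trans hz hyx, h⟩))

/-- Double induction: if `x` and `y` are incomparable while the members of each are comparable with
the other, then they have the same members. -/
theorem IsModelZF.ordinal_trichotomy (hM : IsModelZF M) {x y : M} (hx : IsOrdinal x)
    (hy : IsOrdinal y) : x ∈ₘ y ∨ x = y ∨ y ∈ₘ x := by
  refine hM.ordinal_induction (P := fun x => ∀ y, IsOrdinal y → x ∈ₘ y ∨ x = y ∨ y ∈ₘ x)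
    ?_ (fun x hx ihx => ?_) x hx y hy
  · exact .all (.imp (definablePred_isOrdinal (.var _)) (.or (.mem (.var _) (.var _))
      (.or (.eq (.var _) (.var _)) (.mem (.var _) (.var _)))))
  · refine hM.ordinal_induction (.or (.mem (.const _) (.var _))
      (.or (.eq (.const _) (.var _)) (.mem (.var _) (.const _)))) (fun y hy ihy => ?_)
    by_contra! h
    obtain ⟨h1, h2, h3⟩ := h
    refine h2 (hM.extensionality x y fun z => ⟨fun hz => ?_, fun hz => ?_⟩)
    · rcases ihx z hz y hy with h | rfl | h
      exacts [h, (h3 hz).elim, (h3 (hx.trans h hz)).elim]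
    · rcases ihy z hz with h | rfl | h
      exacts [(h1 (hy.trans h hz)).elim, (h1 hz).elim, h]

theorem IsModelZF.exists_isSuccOf (hM : IsModelZF M) (x : M) : ∃ y, IsSuccOf y x := by
  obtain ⟨s, hs⟩ := hM.pairing x x
  obtain ⟨p, hp⟩ := hM.pairing x s
  obtain ⟨u, hu⟩ := hM.union p
  refine ⟨u, fun z => (hu z).trans ⟨?_, ?_⟩⟩
  · rintro ⟨y, hy, hz⟩
    rcases (hp y).1 hy with rfl | rfl
    exacts [.inl hz, .inr (by simpa using (hs z).1 hz)]
  · rintro (hz | rfl)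
    exacts [⟨x, (hp x).2 (.inl rfl), hz⟩, ⟨s, (hp s).2 (.inr rfl), (hs z).2 (.inl rfl)⟩]

/-- There is an ordinal that contains zero and is closed under successors. -/
theorem IsModelZF.exists_inductive_ordinal (hM : IsModelZF M) :
    ∃ w : M, IsOrdinal w ∧ (∃ e : M, IsEmptySet e ∧ e ∈ₘ w) ∧
      ∀ x : M, x ∈ₘ w → ∃ y : M, IsSuccOf y x ∧ y ∈ₘ w := by
  obtain ⟨w, ⟨e, he, hew⟩, hw⟩ := hM.infinity
  obtain ⟨a, ha⟩ := hM.separation {x | IsOrdinal x}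
    (definablePred_isOrdinal (.var ())).definableClass w
  -- The set `a` of ordinals in `w` need not be transitive. Its union is, and it includes `a`
  -- because `a` is closed under successors.
  obtain ⟨b, hb⟩ := hM.union a
  have hsucc : ∀ x, x ∈ₘ a → ∃ y, IsSuccOf y x ∧ y ∈ₘ a := fun x hx => by
    obtain ⟨hxw, hxo⟩ := (ha x).1 hx
    obtain ⟨y, hy, hyw⟩ := hw x hxw
    exact ⟨y, hy, (ha y).2 ⟨hyw, IsOrdinal.isSuccOf hxo hy⟩⟩
  have hab : ∀ x, x ∈ₘ a → x ∈ₘ b := fun x hx => by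
    obtain ⟨y, hy, hya⟩ := hsucc x hx
    exact (hb x).2 ⟨y, hya, (hy x).2 (.inr rfl)⟩
  have hord : ∀ x, x ∈ₘ a → IsOrdinal x := fun x hx => ((ha x).1 hx).2
  have hbo : IsOrdinal b := by
    refine ⟨fun x hx z hz => ?_, fun x hx => ?_⟩ <;> obtain ⟨y, hy, hxy⟩ := (hb x).1 hx
    · exact (hb z).2 ⟨y, hy, (hord y hy).trans hz hxy⟩
    · exact (hord y hy).2 x hxy
  refine ⟨b, hbo, ⟨e, he, hab e ((ha e).2 ⟨hew, fun y hy => (he y hy).elim,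
    fun y hy => (he y hy).elim⟩)⟩, fun x hx => ?_⟩
  obtain ⟨y, hy, hxy⟩ := (hb x).1 hx
  obtain ⟨s, hs⟩ := hM.exists_isSuccOf x
  refine ⟨s, hs, ?_⟩
  have hyo := hord y hy
  rcases hM.ordinal_trichotomy (IsOrdinal.isSuccOf (hyo.of_mem hxy) hs) hyo with h | rfl | h
  · exact (hb s).2 ⟨y, hy, h⟩
  · exact hab _ hy
  · rcases (hs y).1 h with h | rfl
    · exact (hM.not_mem_self x ((hyo.of_mem hxy).trans hxy h)).elim
    · exact (hM.not_mem_self y hxy).elim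

/-- Every ordinal is zero, a successor or a limit. -/
theorem IsModelZF.ordinal_cases (hM : IsModelZF M) {x : M} (hx : IsOrdinal x) :
    IsEmptySet x ∨ (∃ y, y ∈ₘ x ∧ IsSuccOf x y) ∨ IsLimitOrdinal x := by
  by_cases h0 : ∃ y, y ∈ₘ x
  · by_cases hl : ∀ y, y ∈ₘ x → ∃ z, z ∈ₘ x ∧ y ∈ₘ z
    · exact .inr (.inr ⟨hx, h0, hl⟩)
    · push Not at hl
      obtain ⟨y, hy, hmax⟩ := hl
      refine .inr (.inl ⟨y, hy, fun z => ⟨fun hz => ?_, ?_⟩⟩)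
      · rcases hM.ordinal_trichotomy (hx.of_mem hz) (hx.of_mem hy) with h | h | h
        exacts [.inl h, .inr h, (hmax z hz h).elim]
      · rintro (hz | rfl)
        exacts [hx.trans hz hy, hy]
  · exact .inl fun y hy => h0 ⟨y, hy⟩

end Ordinals

/-! ### Intersections of transitive models -/

section Intersections

variable {M : Type u} [EpsStructure M]

/-- A class that contains all ordinals and is the intersection of transitive models of ZF, in each
of which it is definable, is a model of ZF. -/
theorem isModelZF_of_iInter_range (hM : IsModelZF M) {U : Set M} {ι : Type*} [Nonempty ι]
    {N : ι → Type u} [∀ i, EpsStructure (N i)] (hN : ∀ i, IsModelZF (N i)) {f : ∀ i, N i → M}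
    (hf : ∀ i, IsEpsEmbedding (f i))
    (htrans : ∀ i x y, y ∈ Set.range (f i) → x ∈ₘ y → x ∈ Set.range (f i))
    (hU : ∀ x, x ∈ U ↔ ∀ i, x ∈ Set.range (f i))
    (hdef : ∀ i, DefinableClass {n : N i | f i n ∈ U})
    (hord : ∀ x : M, IsOrdinal x → x ∈ U) : IsModelZF U := by
  have tr : ∀ x y, y ∈ U → x ∈ₘ y → x ∈ U := fun x y hy hx =>
    (hU x).2 fun i => htrans i x y ((hU y).1 hy i) hx
  -- `g i` is the inclusion of `U` factored through `N i`; it presents `U` as a definable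
  -- substructure of `N i`.
  choose g hg using fun (i : ι) (u : U) => (hU u).1 u.2 i
  have hge : ∀ i, IsEpsEmbedding (g i) := fun i =>
    ⟨fun x y h => Subtype.ext (by rw [← hg i x, h, hg i y]), fun x y => by
      rw [← (hf i).eps_iff, hg, hg]; rfl⟩
  have hgr : ∀ i, Set.range (g i) = {n : N i | f i n ∈ U} := fun i => by
    ext n
    constructor
    · rintro ⟨u, rfl⟩
      exact (congrArg (· ∈ U) (hg i u)).mpr u.2
    · exact fun h => ⟨⟨f i n, h⟩, (hf i).injective (hg i _)⟩
  have hgd : ∀ i, DefinableClass (Set.range (g i)) := fun i => hgr i ▸ hdef i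
  -- A set of elements of `U` that belongs to every model belongs to `U`.
  have key : ∀ Q : U → Prop, (∀ i, ∃ b : N i, ∀ n, n ∈ₘ b ↔ ∃ u, g i u = n ∧ Q u) →
      ∃ b : U, ∀ u, u ∈ₘ b ↔ Q u := by
    intro Q h
    have h' : ∀ i, ∃ b ∈ Set.range (f i), ∀ x : M, x ∈ₘ b ↔ ∃ u : U, u = x ∧ Q u := by
      intro i
      obtain ⟨b, hb⟩ := h i
      refine ⟨f i b, ⟨b, rfl⟩, fun x => ⟨fun hx => ?_, ?_⟩⟩
      · obtain ⟨n, rfl⟩ := htrans i x _ ⟨b, rfl⟩ hx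
        obtain ⟨u, rfl, hu⟩ := (hb n).1 (((hf i).eps_iff _ _).1 hx)
        exact ⟨u, (hg i u).symm, hu⟩
      · rintro ⟨u, rfl, hu⟩
        rw [← hg i u, (hf i).eps_iff]
        exact (hb _).2 ⟨u, rfl, hu⟩
    choose b hbr hb using h'
    -- All the `b i` have the same members in `M`, so they are equal and any one of them lies in
    -- every model.
    have hbU : b (Classical.arbitrary ι) ∈ U := (hU _).2 fun i => by
      rw [hM.extensionality (b (Classical.arbitrary ι)) (b i) fun x =>
        (hb _ x).trans (hb i x).symm]
      exact hbr i
    refine ⟨⟨_, hbU⟩, fun u => (hb _ u).trans ⟨?_, fun hu => ⟨u, rfl, hu⟩⟩⟩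
    rintro ⟨u', h, hu'⟩
    rwa [← Subtype.ext h]
  -- A member of an element of `U`, as computed in a model, comes from `U`.
  have mem_g : ∀ i (n : N i) (a : U), n ∈ₘ g i a → ∃ u, g i u = n ∧ u ∈ₘ a := by
    intro i n a h
    have h' : f i n ∈ₘ (a : M) := by rwa [← hg i a, (hf i).eps_iff]
    have hn : n ∈ Set.range (g i) := hgr i ▸ tr _ _ a.2 h'
    obtain ⟨u, rfl⟩ := hn
    exact ⟨u, rfl, ((hge i).eps_iff _ _).1 h⟩
  refine ⟨fun x y h => ?_, fun x hx => ?_, fun a b => ?_, fun a => ?_, fun a => ?_, ?_,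
    fun P hP a => ?_, fun F hF a hFa => ?_⟩
  · refine Subtype.ext (hM.extensionality _ _ fun z => ⟨fun hz => ?_, fun hz => ?_⟩)
    · exact (h ⟨z, tr _ _ x.2 hz⟩).1 hz
    · exact (h ⟨z, tr _ _ y.2 hz⟩).2 hz
  · obtain ⟨y, hy⟩ := hx
    obtain ⟨z, hz, hmin⟩ := hM.foundation x.1 ⟨y.1, hy⟩
    exact ⟨⟨z, tr _ _ x.2 hz⟩, hz, fun t ht => hmin t ht⟩
  · refine key _ fun i => ?_
    obtain ⟨c, hc⟩ := (hN i).pairing (g i a) (g i b)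
    refine ⟨c, fun n => (hc n).trans ⟨?_, ?_⟩⟩
    · rintro (rfl | rfl)
      exacts [⟨a, rfl, .inl rfl⟩, ⟨b, rfl, .inr rfl⟩]
    · rintro ⟨u, rfl, rfl | rfl⟩
      exacts [.inl rfl, .inr rfl]
  · refine key _ fun i => ?_
    obtain ⟨b, hb⟩ := (hN i).union (g i a)
    refine ⟨b, fun n => (hb n).trans ⟨?_, ?_⟩⟩
    · rintro ⟨y, hy, hn⟩
      obtain ⟨y, rfl, hya⟩ := mem_g i y a hy
      obtain ⟨n, rfl, hny⟩ := mem_g i n y hn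
      exact ⟨n, rfl, y, hya, hny⟩
    · rintro ⟨u, rfl, y, hy, hu⟩
      exact ⟨g i y, ((hge i).eps_iff _ _).2 hy, ((hge i).eps_iff _ _).2 hu⟩
  · refine key _ fun i => ?_
    obtain ⟨b, hb⟩ := (hN i).powerset (g i a)
    -- The power set in `N i` may have members outside `U`; definability of `U` in `N i` lets them
    -- be removed.
    obtain ⟨c, hc⟩ := (hN i).separation _ (hgd i) b
    refine ⟨c, fun n => (hc n).trans ⟨?_, ?_⟩⟩
    · rintro ⟨hn, u, rfl⟩
      exact ⟨u, rfl, fun z hz => ((hge i).eps_iff _ _).1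
        ((hb _).1 hn _ (((hge i).eps_iff _ _).2 hz))⟩
    · rintro ⟨u, rfl, hu⟩
      refine ⟨(hb _).2 fun z hz => ?_, u, rfl⟩
      obtain ⟨z, rfl, hzu⟩ := mem_g i z u hz
      exact ((hge i).eps_iff _ _).2 (hu z hzu)
  -- An arbitrary inductive set of `M` need not belong to `U`, but an inductive ordinal does.
  · obtain ⟨w, hw, ⟨e, he, hew⟩, hsucc⟩ := hM.exists_inductive_ordinal
    refine ⟨⟨w, hord w hw⟩, ⟨⟨e, hord e (hw.of_mem hew)⟩, fun z => he z, hew⟩, fun x hx => ?_⟩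
    obtain ⟨y, hy, hyw⟩ := hsucc x hx
    exact ⟨⟨y, hord y (hw.of_mem hyw)⟩, fun z => (hy z).trans (or_congr Iff.rfl
      Subtype.ext_iff.symm), hyw⟩
  · refine key _ fun i => ?_
    obtain ⟨b, hb⟩ := (hN i).separation _ ((hge i).definableClass_image (hgd i) hP) (g i a)
    refine ⟨b, fun n => (hb n).trans ⟨?_, ?_⟩⟩
    · rintro ⟨hn, u, hu, rfl⟩
      exact ⟨u, rfl, ((hge i).eps_iff _ _).1 hn, hu⟩
    · rintro ⟨u, rfl, hua, hu⟩
      exact ⟨((hge i).eps_iff _ _).2 hua, u, hu, rfl⟩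
  · refine key _ fun i => ?_
    have himg : ∀ x y, (g i x, y) ∈ Prod.map (g i) (g i) '' F → ∃ z, g i z = y ∧ (x, z) ∈ F := by
      rintro x y ⟨⟨x', z⟩, hF, h⟩
      obtain ⟨h1, h2⟩ := Prod.ext_iff.1 h
      obtain rfl := (hge i).injective h1
      exact ⟨z, h2, hF⟩
    obtain ⟨b, hb⟩ := (hN i).replacement _ ((hge i).definableRel_image (hgd i) hF) (g i a)
      fun n hn => by
        obtain ⟨x, rfl, hx⟩ := mem_g i n a hn
        obtain ⟨y, hy, huniq⟩ := hFa x hx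
        refine ⟨g i y, ⟨(x, y), hy, rfl⟩, fun z hz => ?_⟩
        obtain ⟨z, rfl, hz'⟩ := himg x z hz
        rw [huniq z hz']
    refine ⟨b, fun n => (hb n).trans ⟨?_, ?_⟩⟩
    · rintro ⟨x, hx, hxn⟩
      obtain ⟨x, rfl, hxa⟩ := mem_g i x a hx
      obtain ⟨y, rfl, hy⟩ := himg x n hxn
      exact ⟨y, rfl, x, hxa, hy⟩
    · rintro ⟨y, rfl, x, hx, hy⟩
      exact ⟨g i x, ((hge i).eps_iff _ _).2 hx, (x, y), hy, rfl⟩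

end Intersections

/-! ### Decreasing sequences of inner models and inner mantles -/

section Sequences

variable {M : Type u} [EpsStructure M]

theorem isModelZF_interBelow (hM : IsModelZF M) {l : M} {W : M → Set M} (hne : ∃ i, i ∈ₘ l)
    (hW : ∀ i : M, i ∈ₘ l → IsModelZF (W i))
    (htrans : ∀ i x y : M, i ∈ₘ l → y ∈ W i → x ∈ₘ y → x ∈ W i)
    (hord : ∀ i x : M, i ∈ₘ l → IsOrdinal x → x ∈ W i)
    (hdef : ∀ i : M, i ∈ₘ l → DefinableClass {x : W i | (x : M) ∈ interBelow l W}) :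
    IsModelZF (interBelow l W) := by
  obtain ⟨k, hk⟩ := hne
  have : Nonempty {i // i ∈ₘ l} := ⟨⟨k, hk⟩⟩
  exact isModelZF_of_iInter_range hM (ι := {i // i ∈ₘ l}) (N := fun i => W i.1)
    (fun i => hW i.1 i.2) (f := fun i => Subtype.val) (fun i => isEpsEmbedding_val _)
    (fun i x y hy hx => by
      rw [Subtype.range_coe] at hy ⊢
      exact htrans i.1 x y i.2 hy hx)
    (fun x => by
      simp only [Subtype.range_coe, Subtype.forall]
      rfl)
    (fun i => hdef i.1 i.2) (fun x hx i hi => hord i x hi hx)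

theorem definableClass_univ : DefinableClass (Set.univ : Set M) :=
  DefinablePred.definableClass (P := fun _ => True) (DefinablePred.false.not.congr fun _ => by simp)

/-- The subtype of `Set.univ` is only a copy of `M`; the axioms pass to it by viewing it as the
intersection of the one-member family `M`. This serves the empty sequence. -/
theorem isModelZF_univ (hM : IsModelZF M) : IsModelZF (Set.univ : Set M) :=
  isModelZF_of_iInter_range hM (ι := Unit) (N := fun _ => M) (fun _ => hM) (f := fun _ x => x)
    (fun _ => ⟨fun _ _ h => h, fun _ _ => Iff.rfl⟩) (fun _ x _ _ _ => ⟨x, rfl⟩)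
    (fun x => ⟨fun _ _ => ⟨x, rfl⟩, fun _ => trivial⟩) (fun _ => definableClass_univ)
    fun _ _ => trivial

/-- The intersection of a decreasing sequence of inner models of ZF, all of whose tails are
definable in the respective inner models, is an inner model of ZF. -/
theorem isInnerModelZF_interBelow (hM : IsModelZF M) {l : M} {W : M → Set M} (hl : IsOrdinal l)
    (hdef : DefinableRel {q : M × M | q.1 ∈ₘ l ∧ q.2 ∈ W q.1})
    (hW : ∀ i : M, i ∈ₘ l → IsInnerModelZF (W i))
    (hdec : ∀ i j : M, i ∈ₘ j → j ∈ₘ l → W j ⊆ W i)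
    (htail : ∀ i : M, i ∈ₘ l →
      DefinableRel {q : W i × W i | i ∈ₘ (q.1 : M) ∧ (q.1 : M) ∈ₘ l ∧ (q.2 : M) ∈ W q.1}) :
    IsInnerModelZF (interBelow l W) where
  definable := by
    have key : DefinablePred fun v : Unit → M => ∀ i, i ∈ₘ l →
        (i, v ()) ∈ {q : M × M | q.1 ∈ₘ l ∧ q.2 ∈ W q.1} :=
      .all (.imp (.mem (.var _) (.const l)) (hdef.definablePred (.var _) (.var _)))
    exact DefinablePred.definableClass (P := fun x => x ∈ interBelow l W)
      (key.congr fun v => forall_congr' fun i => imp_congr_right fun hi => and_iff_right hi)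
  transitive x y hy hx i hi := (hW i hi).transitive x y (hy i hi) hx
  ordinals x hx i hi := (hW i hi).ordinals x hx
  zf := by
    by_cases hne : ∃ i, i ∈ₘ l
    · refine isModelZF_interBelow hM hne (fun i hi => (hW i hi).zf)
        (fun i x y hi => (hW i hi).transitive x y) (fun i x hi => (hW i hi).ordinals x)
        fun i hi => ?_
      have ho : ∀ j, IsOrdinal j → j ∈ W i := (hW i hi).ordinals
      have hio := hl.of_mem hi
      have key : DefinablePred fun v : Unit → W i => ∀ j : W i,
          (⟨i, ho i hio⟩ : W i) ∈ₘ j ∧ j ∈ₘ (⟨l, ho l hl⟩ : W i) →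
          (j, v ()) ∈ {q : W i × W i | i ∈ₘ (q.1 : M) ∧ (q.1 : M) ∈ₘ l ∧ (q.2 : M) ∈ W q.1} :=
        .all (.imp (.and (.mem (.const _) (.var _)) (.mem (.var _) (.const _)))
          ((htail i hi).definablePred (.var _) (.var _)))
      refine DefinablePred.definableClass (P := fun x : W i => (x : M) ∈ interBelow l W)
        (key.congr fun v => ⟨fun H j hj => ?_, fun H j hj => ⟨hj.1, hj.2, H j.1 hj.2⟩⟩)
      -- Only indices `j` above `i` need the tail; for the others `W i ⊆ W j`.
      rcases hM.ordinal_trichotomy hio (hl.of_mem hj) with h | rfl | h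
      · exact (H ⟨j, ho j (hl.of_mem hj)⟩ ⟨h, hj⟩).2.2
      · exact (v ()).2
      · exact hdec j i h hi (v ()).2
    · have : interBelow l W = Set.univ := Set.eq_univ_of_forall fun x i hi => (hne ⟨i, hi⟩).elim
      rw [this]
      exact isModelZF_univ hM

/-- A transitive class that contains all ordinals. -/
structure IsTransitiveWithOrdinals (W : Set M) : Prop where
  transitive : ∀ x y : M, y ∈ W → x ∈ₘ y → x ∈ W
  ordinals : ∀ x : M, IsOrdinal x → x ∈ W

theorem IsTransitiveWithOrdinals.mantleOf {W : Set M} (hW : IsTransitiveWithOrdinals W) :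
    IsTransitiveWithOrdinals (mantleOf W) where
  transitive := by
    rintro x _ ⟨y, hy, rfl⟩ hx
    exact ⟨⟨x, hW.transitive x y y.2 hx⟩, fun V hV => hV.1.transitive _ y (hy V hV) hx, rfl⟩
  ordinals x hx := by
    refine ⟨⟨x, hW.ordinals x hx⟩, fun V hV => hV.1.ordinals _ ?_, rfl⟩
    -- Being an ordinal is a universal condition, so it passes from `M` down to `W`.
    exact ⟨fun y hy z hz => hx.1 y hy z hz, fun y hy z hz w hw => hx.2 y hy z hz w hw⟩

/-- The three clauses of the recursion all preserve the property. The induction takes place in the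
meta-theory if the indices are well-founded, and otherwise inside `M`. -/
theorem IsInnerMantleSeq.isTransitiveWithOrdinals (hM : IsModelZF M) {c : M} {S : M → Set M}
    (hc : IsLimitOrdinal c) (hS : IsInnerMantleSeq c S) (k : M) (hk : k ∈ₘ c) :
    IsTransitiveWithOrdinals (S k) := by
  have step : ∀ k, k ∈ₘ c → (∀ j, j ∈ₘ k → IsTransitiveWithOrdinals (S j)) →
      IsTransitiveWithOrdinals (S k) := by
    intro k hk ih
    rcases hM.ordinal_cases (hc.1.of_mem hk) with h | ⟨j, hj, h⟩ | h
    · rw [hS.zero k hk h]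
      exact ⟨fun _ _ _ _ => trivial, fun _ _ => trivial⟩
    · rw [hS.succ j k (hc.1.trans hj hk) hk h]
      exact (ih j hj).mantleOf
    · rw [hS.limit k hk h]
      exact ⟨fun x y hy hx i hi => (ih i hi).transitive x y (hy i hi) hx,
        fun x hx i hi => (ih i hi).ordinals x hx⟩
  rcases hS.recursion with hwf | hdef
  · exact hwf.induction hk fun k hk ih => step k hk fun j hj => ih j (hc.1.trans hj hk) hj
  -- Only proper initial segments of the sequence are known to be definable. As `c` is a limit, some
  -- `m` in `c` lies above `k`, and the induction is restricted to the indices below `m`.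
  · obtain ⟨m, hm, hkm⟩ := hc.2.2 k hk
    have hR := hdef m hm
    set R := {q : M × M | q.1 ∈ₘ m ∧ q.2 ∈ S q.1}
    have hRS : ∀ {x y}, x ∈ₘ m → ((x, y) ∈ R ↔ y ∈ S x) := fun hx => and_iff_right hx
    have key : DefinablePred fun v : Unit → M => v () ∈ₘ m →
        (∀ b a, (v (), b) ∈ R → a ∈ₘ b → (v (), a) ∈ R) ∧ ∀ a, IsOrdinal a → (v (), a) ∈ R :=
      .imp (.mem (.var _) (.const _)) (.and
        (.all (.all (.imp (hR.definablePred (.var _) (.var _)) (.imp (.mem (.var _) (.var _))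
          (hR.definablePred (.var _) (.var _))))))
        (.all (.imp (definablePred_isOrdinal (.var _)) (hR.definablePred (.var _) (.var _)))))
    refine hM.ordinal_induction (P := fun x => x ∈ₘ m → IsTransitiveWithOrdinals (S x))
      (key.congr fun v => imp_congr_right fun hv => ?_)
      (fun x hx ih hxm => step x (hc.1.trans hxm hm) fun j hj =>
        ih j hj ((hc.1.of_mem hm).trans hj hxm)) k (hc.1.of_mem hk) hkm
    simp only [hRS hv]
    exact ⟨fun h => ⟨fun x y => h.1 y x, h.2⟩, fun h => ⟨fun y x => h.1 x y, h.2⟩⟩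

/-- The intersection of the inner mantles below a limit stage is an inner model of ZF, provided that
it is definable in each of them. -/
theorem IsInnerMantleSeq.isInnerModelZF_interBelow (hM : IsModelZF M) {c : M} {S : M → Set M}
    (hc : IsLimitOrdinal c) (hS : IsInnerMantleSeq c S)
    (hzf : ∀ k : M, k ∈ₘ c → IsModelZF (S k))
    (hdef : ∀ k : M, k ∈ₘ c → DefinableClass {x : S k | (x : M) ∈ interBelow c S}) :
    IsInnerModelZF (interBelow c S) where
  definable := by
    -- The minimal element `e` of the transitive set `c` is zero, so `S e` is all of `M`, and
    -- definability in `S e` becomes definability in `M`.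
    obtain ⟨e, he, hmin⟩ := hM.foundation c hc.2.1
    have hSe : S e = Set.univ := hS.zero e he fun z hz => hmin z hz (hc.1.trans hz he)
    have hr : Set.range (Subtype.val : S e → M) = Set.univ := by rw [Subtype.range_coe, hSe]
    have h := (isEpsEmbedding_val (S e)).definableClass_image (hr ▸ definableClass_univ)
      (hdef e he)
    rwa [show {x : S e | (x : M) ∈ interBelow c S} = Subtype.val ⁻¹' interBelow c S from rfl,
      Set.image_preimage_eq_inter_range, hr, Set.inter_univ] at h
  transitive x y hy hx i hi :=
    (hS.isTransitiveWithOrdinals hM hc i hi).transitive x y (hy i hi) hx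
  ordinals x hx i hi := (hS.isTransitiveWithOrdinals hM hc i hi).ordinals x hx
  zf := isModelZF_interBelow hM hc.2.1 hzf
    (fun i x y hi => (hS.isTransitiveWithOrdinals hM hc i hi).transitive x y)
    (fun i x hi => (hS.isTransitiveWithOrdinals hM hc i hi).ordinals x) hdef

end Sequences

theorem mainTheorem8 {M : Type u} [EpsStructure M] (hM : IsModelZF M) :
    -- Intersections of definable decreasing sequences of inner models of ZF.
    (∀ (l : M) (W : M → Set M), IsOrdinal l →
      DefinableRel {q : M × M | q.1 ∈ₘ l ∧ q.2 ∈ W q.1} →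
      (∀ i : M, i ∈ₘ l → IsInnerModelZF (W i)) →
      (∀ i j : M, i ∈ₘ j → j ∈ₘ l → W j ⊆ W i) →
      (∀ i : M, i ∈ₘ l →
        DefinableRel {q : W i × W i | i ∈ₘ (q.1 : M) ∧ (q.1 : M) ∈ₘ l ∧ (q.2 : M) ∈ W q.1}) →
      IsInnerModelZF (interBelow l W)) ∧
    -- Inner mantles at limit stages; the last hypothesis for `k = 0` says that
    -- the intersection is a definable class of `M` itself.
    (∀ (c : M) (S : M → Set M), IsLimitOrdinal c →
      IsInnerMantleSeq c S →
      (∀ k : M, k ∈ₘ c → IsModelZFC (S k)) →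
      (∀ k : M, k ∈ₘ c → DefinableClass {x : S k | (x : M) ∈ interBelow c S}) →
      IsInnerModelZF (interBelow c S)) := by
  exact ⟨fun l W hl hdef hW hdec htail => isInnerModelZF_interBelow hM hl hdef hW hdec htail,
    fun c S hc hS hzfc hdef => hS.isInnerModelZF_interBelow hM hc (fun k hk => (hzfc k hk).zf) hdef⟩
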